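/- **Setting.** Let $p$ and $T$ be integers, let $1\le n_0<T$ be an integer, let $X^{(1)},\dots,X^{(T)}\in\mathbb R^p$, and put $\mathcal T=\{n_0,\dots,T-n_0\}$. Let $\alpha\in[0,1)$ and let $\lambda_{j,\tau}>0$ for $j\in\{1,2\}$, $\tau\in\mathcal T$. Let $\mathcal M_p^+$ be the set of symmetric positive definite $p\times p$ real matrices, and for $0<a\le A$ let $\mathcal M_p^+(a,A)$ be the set of those with all eigenvalues in $[a,A]$. Write $\|\cdot\|_F$ for the Frobenius norm and $\|\cdot\|_2$ for the spectral norm. For $\tau\in\mathcal T$ let $$S_1(\tau)=\frac1\tau\sum_{t=1}^{\tau}X^{(t)}X^{(t)\prime},\quad S_2(\tau)=\frac1{T-\tau}\sum_{t=\tau+1}^{T}X^{(t)}X^{(t)\prime},\quad w_1(\tau)=\frac{\tau}{2T},\quad w_2(\tau)=\frac12\Big(1-\frac{\tau}{T}\Big),$$ $$g_{j,\tau}(\theta)=w_j(\tau)\big[-\log\det\theta+\mathrm{Tr}(\theta S_j(\tau))\big]\ \text{ for }\theta\in\mathcal M_p^+,\qquad g_{j,\tau}(\theta)=+\infty\ \text{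 otherwise},$$ $$\wp(\theta)=\alpha\sum_{i,l=1}^p|\theta_{il}|+\frac{1-\alpha}{2}\|\theta\|_F^2,\qquad \hat\theta_{j,\tau}=\operatorname*{Argmin}_{\vartheta\in\mathcal M_p^+}\big[g_{j,\tau}(\vartheta)+\lambda_{j,\tau}\wp(\vartheta)\big],$$ $$\mathcal H(\tau\mid\theta_1,\theta_2)=g_{1,\tau}(\theta_1)+\lambda_{1,\tau}\wp(\theta_1)+g_{2,\tau}(\theta_2)+\lambda_{2,\tau}\wp(\theta_2).$$ For $s>0$ let $\mathrm{Prox}_s(\theta)$ be the matrix whose $(i,l)$ entry is $0$ if $|\theta_{il}|<\alpha s$, $\frac{\theta_{il}-\alpha s}{1+(1-\alpha)s}$ if $\theta_{il}\ge\alpha s$, and $\frac{\theta_{il}+\alpha s}{1+(1-\alpha)s}$ if $\theta_{il}\le-\alpha s$. **Approximate MM algorithm** with step size $\gamma>0$: start from $\tau^{(0)}\in\mathcal T$ and $\theta_1^{(0)},\theta_2^{(0)}\in\mathcal M_p^+$; for $k\ge1$ and $j=1,2$ set $$\theta_j^{(k)}=\mathrm{Prox}_{\gamma\lambda_{j,\tau^{(k-1)}}}\Big(\theta_j^{(k-1)}-\gamma\,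 w_j(\tau^{(k-1)})\big(S_j(\tau^{(k-1)})-(\theta_j^{(k-1)})^{-1}\big)\Big),$$ and let $\tau^{(k)}$ be any minimizer of $t\mapsto\mathcal H(t\mid\theta_1^{(k)},\theta_2^{(k)})$ over $\mathcal T$. **Constants.** $\underline\lambda_j=\min_{\tau\in\mathcal T}\lambda_{j,\tau}$, $\bar\lambda_j=\max_{\tau\in\mathcal T}\lambda_{j,\tau}$, $\mu_j=\max_{\tau\in\mathcal T}\big[\frac12\|S_j(\tau)\|_2+\alpha p\lambda_{j,\tau}\big]$, $$b_j=\frac{-\mu_j+\sqrt{\mu_j^2+2\bar\lambda_j(1-\alpha)n_0/T}}{2(1-\alpha)\bar\lambda_j},\qquad B_j=\frac{\mu_j+\sqrt{\mu_j^2+2\underline\lambda_j(1-\alpha)}}{2(1-\alpha)\underline\lambda_j}.$$ **Containment assumption H1** (with $\epsilon>0$, $c\ge0$, $\kappa\in[0,1)$, $\tau_\star\in\mathcal T$): for every $\tau\in\mathcal T$ and all $\theta_1,\theta_2\in\mathcal M_p^+$ with $\|\theta_1-\hat\theta_{1,\tau}\|_F+\|\theta_2-\hat\theta_{2,\tau}\|_F\le\epsilon$,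 every minimizer $t$ of $\mathcal H(\cdot\mid\theta_1,\theta_2)$ over $\mathcal T$ satisfies $|t-\tau_\star|\le\kappa|\tau-\tau_\star|+c$. **Theorem.** Suppose $\gamma\in(0,\min(b_1^2,b_2^2)]$ and $\theta_j^{(0)}\in\mathcal M_p^+(b_j,B_j)$ for $j=1,2$. Then the minimizers $\hat\theta_{j,\tau}$ exist and are unique, all iterates $\theta_j^{(k)}$ are positive definite (so that the algorithm is well defined), and $$\lim_{k\to\infty}\|\theta_1^{(k)}-\hat\theta_{1,\tau^{(k)}}\|_F=0,\qquad \lim_{k\to\infty}\|\theta_2^{(k)}-\hat\theta_{2,\tau^{(k)}}\|_F=0.$$ If moreover H1 holds with some $\epsilon,c,\kappa,\tau_\star$, then $$\limsup_{k\to\infty}|\tau^{(k)}-\tau_\star|\le\frac{c}{1-\kappa}.$$ -/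

import Mathlib

open Filter Topology

/-- The data of the single change-point problem: `T` observations `X 1, …, X T` in `ℝ^p`, the grid
parameter `n₀`, the elastic-net mixing parameter `α` and the regularization parameters `lam j τ`.
The index `j : Fin 2` stands for the segment: `0` is the segment before the change-point (`j = 1` in
the usual notation) and `1` is the segment after it (`j = 2` in the usual notation). -/
structure ChangePointProblem (p : ℕ) where
  T : ℕ
  n₀ : ℕ
  X : ℕ → Fin p → ℝ
  α : ℝ
  lam : Fin 2 → ℕ → ℝ

/-- The Frobenius norm of a matrix. -/
noncomputable def frobNorm {p : ℕ} (A : Matrix (Fin p) (Fin p) ℝ) : ℝ :=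
  Real.sqrt (∑ i, ∑ j, A i j ^ 2)

/-- The spectral norm of a matrix: its operator norm on Euclidean space. -/
noncomputable def specNorm {p : ℕ} (A : Matrix (Fin p) (Fin p) ℝ) : ℝ :=
  ‖Matrix.toEuclideanCLM (n := Fin p) (𝕜 := ℝ) A‖

/-- `PDBetween a A θ`: `θ` is symmetric positive definite with all its eigenvalues in `[a, A]`. -/
def PDBetween {p : ℕ} (a A : ℝ) (θ : Matrix (Fin p) (Fin p) ℝ) : Prop :=
  ∃ h : θ.PosDef, ∀ i, a ≤ h.isHermitian.eigenvalues i ∧ h.isHermitian.eigenvalues i ≤ A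

namespace ChangePointProblem

variable {p : ℕ} (P : ChangePointProblem p)

/-- The search grid `{n₀, …, T - n₀}`. -/
def grid : Set ℕ := Set.Icc P.n₀ (P.T - P.n₀)

/-- The sample second-moment matrices: the average of `X t (X t)'` over `1 ≤ t ≤ τ` for the first
segment, over `τ + 1 ≤ t ≤ T` for the second segment. -/
noncomputable def S (j : Fin 2) (τ : ℕ) : Matrix (Fin p) (Fin p) ℝ :=
  if j = 0 then
    ((τ : ℝ)⁻¹) • ∑ t ∈ Finset.Icc 1 τ, Matrix.vecMulVec (P.X t) (P.X t)
  else
    (((P.T : ℝ) - τ)⁻¹) • ∑ t ∈ Finset.Icc (τ + 1) P.T, Matrix.vecMulVec (P.X t) (P.X t)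

/-- The weight of each segment in the likelihood: `τ / (2T)` and `(1 - τ / T) / 2`. -/
noncomputable def weight (j : Fin 2) (τ : ℕ) : ℝ :=
  if j = 0 then (1 / 2) * ((τ : ℝ) / P.T) else (1 / 2) * (1 - (τ : ℝ) / P.T)

/-- The elastic-net penalty `α ‖θ‖₁ + (1 - α) / 2 ‖θ‖_F²`. -/
noncomputable def pen (θ : Matrix (Fin p) (Fin p) ℝ) : ℝ :=
  P.α * (∑ i, ∑ j, |θ i j|) + (1 - P.α) / 2 * frobNorm θ ^ 2

open Classical in
/-- The weighted negative log-likelihood of a segment, `+∞` off the positive definite matrices. -/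
noncomputable def g (j : Fin 2) (τ : ℕ) (θ : Matrix (Fin p) (Fin p) ℝ) : EReal :=
  if θ.PosDef then
    ((P.weight j τ * (-Real.log θ.det + (θ * P.S j τ).trace) : ℝ) : EReal)
  else ⊤

/-- The penalized objective of a segment. -/
noncomputable def obj (j : Fin 2) (τ : ℕ) (θ : Matrix (Fin p) (Fin p) ℝ) : EReal :=
  P.g j τ θ + ((P.lam j τ * P.pen θ : ℝ) : EReal)

/-- `ϑ` minimizes the penalized objective over the positive definite matrices. -/
def IsGlasso (j : Fin 2) (τ : ℕ) (ϑ : Matrix (Fin p) (Fin p) ℝ) : Prop :=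
  ϑ.PosDef ∧ ∀ θ : Matrix (Fin p) (Fin p) ℝ, θ.PosDef → P.obj j τ ϑ ≤ P.obj j τ θ

/-- The elastic-net graphical lasso solution of segment `j` at `τ`. -/
noncomputable def glasso (j : Fin 2) (τ : ℕ) : Matrix (Fin p) (Fin p) ℝ :=
  Classical.epsilon (P.IsGlasso j τ)

/-- The joint objective as a function of the change-point. -/
noncomputable def H (τ : ℕ) (θ₁ θ₂ : Matrix (Fin p) (Fin p) ℝ) : EReal :=
  P.obj 0 τ θ₁ + P.obj 1 τ θ₂

/-- The set of minimizers over the grid of the joint objective. -/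
def argminH (θ₁ θ₂ : Matrix (Fin p) (Fin p) ℝ) : Set ℕ :=
  {τ | τ ∈ P.grid ∧ ∀ t ∈ P.grid, P.H τ θ₁ θ₂ ≤ P.H t θ₁ θ₂}

/-- The proximal map of `s` times the elastic-net penalty: entrywise soft-thresholding at level
`α s` followed by shrinkage. -/
noncomputable def prox (s : ℝ) (θ : Matrix (Fin p) (Fin p) ℝ) : Matrix (Fin p) (Fin p) ℝ :=
  Matrix.of fun i j =>
    if |θ i j| < P.α * s then 0
    else if P.α * s ≤ θ i j then (θ i j - P.α * s) / (1 + (1 - P.α) * s)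
    else (θ i j + P.α * s) / (1 + (1 - P.α) * s)

/-- The gradient of `g j τ` at a positive definite matrix `θ`. -/
noncomputable def gradG (j : Fin 2) (τ : ℕ) (θ : Matrix (Fin p) (Fin p) ℝ) :
    Matrix (Fin p) (Fin p) ℝ :=
  P.weight j τ • (P.S j τ - θ⁻¹)

/-- `(τ, θ)` is an infinite run of the approximate majorize-minimize algorithm with step size `γ`:
one proximal-gradient step on each segment at the current change-point, then a minimization over
the grid (ties may be broken in any way). -/
structure IsRun (γ : ℝ) (τ : ℕ → ℕ) (θ : Fin 2 → ℕ → Matrix (Fin p) (Fin p) ℝ) : Prop where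
  τ_zero : τ 0 ∈ P.grid
  θ_zero : ∀ j, (θ j 0).PosDef
  θ_succ : ∀ j k, θ j (k + 1) =
    P.prox (γ * P.lam j (τ k)) (θ j k - γ • P.gradG j (τ k) (θ j k))
  τ_succ : ∀ k, τ (k + 1) ∈ P.argminH (θ 0 (k + 1)) (θ 1 (k + 1))

/-- The smallest regularization parameter over the grid. -/
noncomputable def lamMin (j : Fin 2) : ℝ := ⨅ τ : P.grid, P.lam j τ

/-- The largest regularization parameter over the grid. -/
noncomputable def lamMax (j : Fin 2) : ℝ := ⨆ τ : P.grid, P.lam j τ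

/-- The largest value over the grid of `‖S j τ‖₂ / 2 + α p lam j τ`. -/
noncomputable def mu (j : Fin 2) : ℝ :=
  ⨆ τ : P.grid, ((1 / 2) * specNorm (P.S j τ) + P.α * p * P.lam j τ)

/-- The lower spectral bound. -/
noncomputable def b (j : Fin 2) : ℝ :=
  (-P.mu j + Real.sqrt (P.mu j ^ 2 + 2 * P.lamMax j * (1 - P.α) * ((P.n₀ : ℝ) / P.T))) /
    (2 * (1 - P.α) * P.lamMax j)

/-- The upper spectral bound. -/
noncomputable def B (j : Fin 2) : ℝ :=
  (P.mu j + Real.sqrt (P.mu j ^ 2 + 2 * P.lamMin j * (1 - P.α))) /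
    (2 * (1 - P.α) * P.lamMin j)

/-- The containment assumption with parameters `ε, c, κ, τs`. -/
structure Containment (ε c κ : ℝ) (τs : ℕ) : Prop where
  ε_pos : 0 < ε
  c_nonneg : 0 ≤ c
  κ_nonneg : 0 ≤ κ
  κ_lt_one : κ < 1
  τs_mem : τs ∈ P.grid
  contain : ∀ τ ∈ P.grid, ∀ θ₁ θ₂ : Matrix (Fin p) (Fin p) ℝ, θ₁.PosDef → θ₂.PosDef →
    frobNorm (θ₁ - P.glasso 0 τ) + frobNorm (θ₂ - P.glasso 1 τ) ≤ ε →
    ∀ t ∈ P.argminH θ₁ θ₂, |(t : ℝ) - τs| ≤ κ * |(τ : ℝ) - τs| + c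

end ChangePointProblem

/-! ### Inequalities for positive definite matrices, their inverses and `log det`. -/

section MatrixLemmas

open Matrix

/-! Fix a segment and a change-point. On the matrices `θ ≥ b`, the gradient part of the step is `θ ↦
θ + c θ⁻¹` up to a constant. It is nonexpansive for `c ≤ b²` (`frobNorm_add_smul_inv_sub_le`), and
the strongly convex penalty makes the proximal map a strict contraction. The equation defining `b`
makes `θ ≥ b` invariant (`specGE_step`). Banach's theorem then gives a fixed point, and quadratic
growth around it shows that it is the unique minimizer.

Along a run the change-point moves, so the contractions cannot simply be iterated. Instead the joint
objective decreases: each proximal step lowers it by at least `(2γ)⁻¹` times the squared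
displacement, and the grid minimization cannot raise it (`objReal_succ_le`). It is bounded below, so
displacements tend to zero. By contraction, the displacement controls the distance to the current
minimizer (`frobNorm_step_sub_glasso_le`), uniformly over the finite grid. Eventually the
containment assumption applies at every step, and the change-point error obeys an affine recursion
with slope `κ < 1`. -/

theorem posDef_of_sub_smul_one {m : Type*} [DecidableEq m] {b : ℝ} {θ : Matrix m m ℝ} (hb : 0 < b)
    (h : (θ - b • (1 : Matrix m m ℝ)).PosSemidef) : θ.PosDef := by
  have := Matrix.PosDef.posSemidef_add h (Matrix.PosDef.one.smul hb)
  simpa using this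

variable {n : Type*} [Fintype n] [DecidableEq n]

open scoped MatrixOrder in
theorem Matrix.PosSemidef.exists_eq_conjTranspose_mul_self {A : Matrix n n ℝ} (hA : A.PosSemidef) :
    ∃ C : Matrix n n ℝ, A = Cᴴ * C :=
  CStarAlgebra.nonneg_iff_eq_star_mul_self.mp hA.nonneg

theorem Matrix.PosSemidef.trace_mul_nonneg {A B : Matrix n n ℝ} (hA : A.PosSemidef)
    (hB : B.PosSemidef) : 0 ≤ (A * B).trace := by
  obtain ⟨C, rfl⟩ := hB.exists_eq_conjTranspose_mul_self
  rw [← Matrix.mul_assoc, Matrix.trace_mul_cycle]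
  exact (hA.mul_mul_conjTranspose_same C).trace_nonneg

theorem Matrix.PosDef.log_det_le_trace_sub {A : Matrix n n ℝ} (hA : A.PosDef) :
    Real.log A.det ≤ A.trace - Fintype.card n := by
  have h1 := hA.isHermitian.det_eq_prod_eigenvalues
  have h2 := hA.isHermitian.trace_eq_sum_eigenvalues
  simp only [RCLike.ofReal_real_eq_id, id_eq] at h1 h2
  rw [h1, h2, Real.log_prod fun i _ => (hA.eigenvalues_pos i).ne', ← Finset.card_univ,
    Finset.cast_card, ← Finset.sum_sub_distrib]
  exact Finset.sum_le_sum fun i _ => Real.log_le_sub_one_of_pos (hA.eigenvalues_pos i)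

/-- The concavity inequality for `log det`. -/
theorem Matrix.PosDef.log_det_sub_log_det_le {A B : Matrix n n ℝ} (hA : A.PosDef) (hB : B.PosDef) :
    Real.log B.det - Real.log A.det ≤ (A⁻¹ * (B - A)).trace := by
  -- Congruence by `C`, where `A⁻¹ = Cᴴ C`, reduces to the case `A = 1`.
  obtain ⟨C, hC⟩ := hA.inv.posSemidef.exists_eq_conjTranspose_mul_self
  have hCu : IsUnit C := by
    have h := hA.inv.isUnit
    rw [Matrix.isUnit_iff_isUnit_det, hC, Matrix.det_mul] at h
    rw [Matrix.isUnit_iff_isUnit_det]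
    exact isUnit_of_mul_isUnit_right h
  have hD : (C * B * Cᴴ).PosDef := hB.mul_mul_conjTranspose_same <|
    Matrix.vecMul_injective_iff_isUnit.mpr hCu
  have hdet : (C * B * Cᴴ).det = A.det⁻¹ * B.det := by
    have := congrArg Matrix.det hC
    rw [Matrix.det_nonsing_inv, Ring.inverse_eq_inv', Matrix.det_mul] at this
    rw [this, Matrix.det_mul, Matrix.det_mul]
    ring
  have htr : (C * B * Cᴴ).trace = (A⁻¹ * B).trace := by
    rw [hC, Matrix.trace_mul_cycle]
  have h := hD.log_det_le_trace_sub
  rw [hdet, htr, Real.log_mul (inv_ne_zero hA.det_pos.ne') hB.det_pos.ne', Real.log_inv] at h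
  rw [Matrix.mul_sub, Matrix.nonsing_inv_mul _ ((Matrix.isUnit_iff_isUnit_det _).mp hA.isUnit),
    Matrix.trace_sub, Matrix.trace_one]
  linarith

variable {b c : ℝ} {θ : Matrix n n ℝ}

theorem posSemidef_inv_sub_sq (hb : 0 < b) (h : (θ - b • (1 : Matrix n n ℝ)).PosSemidef) :
    (θ⁻¹ - b • (θ⁻¹ * θ⁻¹)).PosSemidef := by
  have hθ := posDef_of_sub_smul_one hb h
  have hu := (Matrix.isUnit_iff_isUnit_det _).mp hθ.isUnit
  have := h.mul_mul_conjTranspose_same θ⁻¹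
  rw [hθ.inv.isHermitian.eq] at this
  convert this using 1
  simp [Matrix.mul_sub, Matrix.sub_mul, Matrix.nonsing_inv_mul _ hu]

/-- Conjugate `(θ - b) θ = (θ - b)² + b (θ - b)` by `θ⁻¹`. -/
theorem posSemidef_one_sub_inv (hb : 0 < b) (h : (θ - b • (1 : Matrix n n ℝ)).PosSemidef) :
    (1 - b • θ⁻¹).PosSemidef := by
  have hθ := posDef_of_sub_smul_one hb h
  have hu := (Matrix.isUnit_iff_isUnit_det _).mp hθ.isUnit
  have hR : ((θ - b • (1 : Matrix n n ℝ)) * θ).PosSemidef := by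
    have h1 := Matrix.posSemidef_conjTranspose_mul_self (θ - b • (1 : Matrix n n ℝ))
    rw [h.isHermitian.eq] at h1
    convert h1.add (h.smul hb.le) using 1
    simp only [Matrix.mul_sub, Matrix.mul_smul, Matrix.mul_one]
    abel
  have := hR.mul_mul_conjTranspose_same θ⁻¹
  rw [hθ.inv.isHermitian.eq] at this
  convert this using 1
  rw [Matrix.mul_assoc, Matrix.mul_assoc, Matrix.mul_nonsing_inv _ hu]
  simp [Matrix.mul_sub, Matrix.nonsing_inv_mul _ hu]

/-- `x ↦ x + c / x` is increasing on `[b, ∞)` if `c ≤ b²`, in matrix form. -/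
theorem posSemidef_add_smul_inv (hb : 0 < b) (hcb : c ≤ b ^ 2)
    (h : (θ - b • (1 : Matrix n n ℝ)).PosSemidef) :
    (θ + c • θ⁻¹ - (b + c / b) • (1 : Matrix n n ℝ)).PosSemidef := by
  have hθ := posDef_of_sub_smul_one hb h
  have hu := (Matrix.isUnit_iff_isUnit_det _).mp hθ.isUnit
  -- The target equals `(θ - b) θ⁻¹ (θ - b) + (b - c / b) (1 - b θ⁻¹)`.
  have h1 := hθ.inv.posSemidef.mul_mul_conjTranspose_same (θ - b • (1 : Matrix n n ℝ))
  have hd : 0 ≤ b - c / b := by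
    rw [sub_nonneg, div_le_iff₀ hb]; nlinarith
  rw [h.isHermitian.eq] at h1
  have hsum := h1.add ((posSemidef_one_sub_inv hb h).smul hd)
  refine (congrArg Matrix.PosSemidef ?_).mp hsum
  simp only [Matrix.mul_sub, Matrix.sub_mul, Matrix.mul_smul, Matrix.smul_mul, Matrix.mul_one,
    Matrix.one_mul, Matrix.mul_nonsing_inv _ hu, Matrix.nonsing_inv_mul _ hu]
  obtain ⟨k, rfl⟩ : ∃ k, c = k * b := ⟨c / b, by field_simp⟩
  rw [mul_div_cancel_right₀ _ hb.ne']
  module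

variable {θ₁ θ₂ : Matrix n n ℝ}

/-- Apply `b θ⁻¹ ≤ 1` to one factor at a time. For `D = θ₂ - θ₁` the product `θ₁⁻¹ D θ₂⁻¹` is `θ₁⁻¹
- θ₂⁻¹`. -/
theorem trace_mul_mul_le (hb : 0 < b) (h₁ : (θ₁ - b • (1 : Matrix n n ℝ)).PosSemidef)
    (h₂ : (θ₂ - b • (1 : Matrix n n ℝ)).PosSemidef) (D : Matrix n n ℝ) :
    b ^ 2 * (θ₁⁻¹ * D * θ₂⁻¹ * Dᵀ).trace ≤ (D * Dᵀ).trace := by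
  have hp₂ := (posDef_of_sub_smul_one hb h₂).inv.posSemidef
  have e1 := (posSemidef_one_sub_inv hb h₁).trace_mul_nonneg (hp₂.mul_mul_conjTranspose_same D)
  have e2 := (posSemidef_one_sub_inv hb h₂).trace_mul_nonneg
    (Matrix.posSemidef_conjTranspose_mul_self D)
  simp only [conjTranspose_eq_transpose_of_trivial, Matrix.sub_mul, Matrix.one_mul,
    Matrix.smul_mul, Matrix.trace_sub, Matrix.trace_smul, smul_eq_mul, sub_nonneg] at e1 e2
  have t1 : (θ₁⁻¹ * (D * θ₂⁻¹ * Dᵀ)).trace = (θ₁⁻¹ * D * θ₂⁻¹ * Dᵀ).trace := by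
    simp only [Matrix.mul_assoc]
  have t2 : (D * θ₂⁻¹ * Dᵀ).trace = (θ₂⁻¹ * (Dᵀ * D)).trace := by
    rw [Matrix.mul_assoc, Matrix.trace_mul_comm, Matrix.mul_assoc]
  rw [t1, t2] at e1
  rw [Matrix.trace_mul_comm Dᵀ D] at e2
  nlinarith

theorem trace_mul_mul_nonneg (h₁ : θ₁.PosDef) (h₂ : θ₂.PosDef) (D : Matrix n n ℝ) :
    0 ≤ (θ₁⁻¹ * D * θ₂⁻¹ * Dᵀ).trace := by
  have := h₁.inv.posSemidef.trace_mul_nonneg (h₂.inv.posSemidef.mul_mul_conjTranspose_same D)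
  simpa only [conjTranspose_eq_transpose_of_trivial, Matrix.mul_assoc] using this

/-- Cocoercivity of the inverse, from `b θ⁻² ≤ θ⁻¹` in each factor. -/
theorem trace_sq_mul_mul_le (hb : 0 < b) (h₁ : (θ₁ - b • (1 : Matrix n n ℝ)).PosSemidef)
    (h₂ : (θ₂ - b • (1 : Matrix n n ℝ)).PosSemidef) (D : Matrix n n ℝ) :
    b ^ 2 * ((θ₁⁻¹ * D * θ₂⁻¹) * (θ₁⁻¹ * D * θ₂⁻¹)ᵀ).trace ≤ (θ₁⁻¹ * D * θ₂⁻¹ * Dᵀ).trace := by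
  have hp₁ := (posDef_of_sub_smul_one hb h₁).inv
  have hp₂ := (posDef_of_sub_smul_one hb h₂).inv
  have hs₁ : (θ₁⁻¹)ᵀ = θ₁⁻¹ := hp₁.isHermitian.eq
  have hs₂ : (θ₂⁻¹)ᵀ = θ₂⁻¹ := hp₂.isHermitian.eq
  have q := Matrix.posSemidef_self_mul_conjTranspose (D * θ₂⁻¹)
  have e1 := (posSemidef_inv_sub_sq hb h₁).trace_mul_nonneg q
  have e2 := (posSemidef_inv_sub_sq hb h₂).trace_mul_nonneg
    (hp₁.posSemidef.conjTranspose_mul_mul_same D)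
  simp only [conjTranspose_eq_transpose_of_trivial, Matrix.sub_mul, Matrix.transpose_mul, hs₁, hs₂,
    Matrix.smul_mul, Matrix.trace_sub, Matrix.trace_smul, smul_eq_mul, sub_nonneg] at e1 e2 ⊢
  have t1 : (θ₁⁻¹ * D * θ₂⁻¹ * (θ₂⁻¹ * (Dᵀ * θ₁⁻¹))).trace =
      (θ₁⁻¹ * θ₁⁻¹ * (D * θ₂⁻¹ * (θ₂⁻¹ * Dᵀ))).trace := by
    rw [Matrix.mul_assoc θ₁⁻¹ θ₁⁻¹, Matrix.trace_mul_comm θ₁⁻¹ (θ₁⁻¹ * _)]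
    simp only [Matrix.mul_assoc]
  have t2 : (θ₁⁻¹ * (D * θ₂⁻¹ * (θ₂⁻¹ * Dᵀ))).trace =
      (θ₂⁻¹ * θ₂⁻¹ * (Dᵀ * θ₁⁻¹ * D)).trace := by
    rw [Matrix.trace_mul_comm (θ₂⁻¹ * θ₂⁻¹)]
    rw [show θ₁⁻¹ * (D * θ₂⁻¹ * (θ₂⁻¹ * Dᵀ)) = (θ₁⁻¹ * D * (θ₂⁻¹ * θ₂⁻¹)) * Dᵀ by
      simp only [Matrix.mul_assoc], Matrix.trace_mul_comm]
    simp only [Matrix.mul_assoc]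
  have t3 : (θ₂⁻¹ * (Dᵀ * θ₁⁻¹ * D)).trace = (θ₁⁻¹ * D * θ₂⁻¹ * Dᵀ).trace := by
    rw [Matrix.trace_mul_comm, Matrix.trace_mul_comm _ Dᵀ]
    simp only [Matrix.mul_assoc]
  rw [t2] at e1
  rw [t3] at e2
  rw [t1]
  nlinarith

end MatrixLemmas

/-! ### Frobenius and spectral norm estimates. -/

section Frobenius

open Matrix

variable {p : ℕ}

theorem trace_mul_transpose_eq_sum (A B : Matrix (Fin p) (Fin p) ℝ) :
    (A * Bᵀ).trace = ∑ i, ∑ j, A i j * B i j := by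
  simp [Matrix.trace, Matrix.mul_apply]

theorem frobNorm_sq (A : Matrix (Fin p) (Fin p) ℝ) : frobNorm A ^ 2 = ∑ i, ∑ j, A i j ^ 2 :=
  Real.sq_sqrt (by positivity)

theorem frobNorm_sq_eq_trace (A : Matrix (Fin p) (Fin p) ℝ) :
    frobNorm A ^ 2 = (A * Aᵀ).trace := by
  rw [frobNorm_sq, trace_mul_transpose_eq_sum]
  simp only [sq]

theorem frobNorm_nonneg (A : Matrix (Fin p) (Fin p) ℝ) : 0 ≤ frobNorm A := Real.sqrt_nonneg _

open scoped Matrix.Norms.Frobenius in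
theorem frobNorm_eq_norm (A : Matrix (Fin p) (Fin p) ℝ) : frobNorm A = ‖A‖ := by
  simp [frobNorm, Matrix.frobenius_norm_def, Real.sqrt_eq_rpow]

open scoped Matrix.Norms.Frobenius in
theorem frobNorm_add_le (A B : Matrix (Fin p) (Fin p) ℝ) :
    frobNorm (A + B) ≤ frobNorm A + frobNorm B := by
  simp only [frobNorm_eq_norm]
  exact norm_add_le A B

open scoped Matrix.Norms.Frobenius in
theorem frobNorm_sub_rev (A B : Matrix (Fin p) (Fin p) ℝ) :
    frobNorm (A - B) = frobNorm (B - A) := by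
  simp only [frobNorm_eq_norm]
  exact norm_sub_rev A B

open scoped Matrix.Norms.Frobenius in
theorem frobNorm_eq_zero {A : Matrix (Fin p) (Fin p) ℝ} : frobNorm A = 0 ↔ A = 0 := by
  rw [frobNorm_eq_norm, norm_eq_zero]

/-- `θ ↦ θ + c θ⁻¹` is nonexpansive on the matrices bounded below by `b`, if `c ≤ b²`. -/
theorem frobNorm_add_smul_inv_sub_le {b c : ℝ} (hb : 0 < b) (hc : 0 ≤ c) (hcb : c ≤ b ^ 2)
    {θ₁ θ₂ : Matrix (Fin p) (Fin p) ℝ}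
    (h₁ : (θ₁ - b • (1 : Matrix (Fin p) (Fin p) ℝ)).PosSemidef)
    (h₂ : (θ₂ - b • (1 : Matrix (Fin p) (Fin p) ℝ)).PosSemidef) :
    frobNorm ((θ₁ + c • θ₁⁻¹) - (θ₂ + c • θ₂⁻¹)) ≤ frobNorm (θ₁ - θ₂) := by
  have hu₁ := (Matrix.isUnit_iff_isUnit_det _).mp (posDef_of_sub_smul_one hb h₁).isUnit
  have hu₂ := (Matrix.isUnit_iff_isUnit_det _).mp (posDef_of_sub_smul_one hb h₂).isUnit
  set D := θ₁ - θ₂ with hD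
  set E := θ₁⁻¹ * D * θ₂⁻¹ with hE
  have hEq : (θ₁ + c • θ₁⁻¹) - (θ₂ + c • θ₂⁻¹) = D - c • E := by
    have : E = θ₂⁻¹ - θ₁⁻¹ := by
      rw [hE, hD, Matrix.mul_sub, Matrix.sub_mul, Matrix.nonsing_inv_mul _ hu₁, Matrix.one_mul,
        Matrix.mul_assoc, Matrix.mul_nonsing_inv _ hu₂, Matrix.mul_one]
    rw [this, hD, smul_sub]
    abel
  have e1 := trace_sq_mul_mul_le hb h₁ h₂ D
  have e2 := trace_mul_mul_nonneg (posDef_of_sub_smul_one hb h₁) (posDef_of_sub_smul_one hb h₂) D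
  rw [← hE] at e1 e2
  have e3 : 0 ≤ (E * Eᵀ).trace := by rw [← frobNorm_sq_eq_trace]; positivity
  rw [hEq]
  refine le_of_sq_le_sq ?_ (frobNorm_nonneg _)
  rw [frobNorm_sq_eq_trace, frobNorm_sq_eq_trace]
  have e4 : (D * Eᵀ).trace = (E * Dᵀ).trace := by
    rw [← Matrix.trace_transpose]; simp
  simp only [Matrix.transpose_sub, Matrix.transpose_smul, Matrix.mul_sub, Matrix.sub_mul,
    Matrix.mul_smul, Matrix.smul_mul, Matrix.trace_sub, Matrix.trace_smul, smul_eq_mul, e4]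
  -- In `‖D - c E‖² = ‖D‖² - 2c⟨E, D⟩ + c²‖E‖²`, the last term is at most `c⟨E, D⟩` by cocoercivity.
  have e5 : c * (E * Eᵀ).trace ≤ b ^ 2 * (E * Eᵀ).trace := mul_le_mul_of_nonneg_right hcb e3
  nlinarith [mul_le_mul_of_nonneg_left (e5.trans e1) hc, mul_nonneg hc e2]

/-- The gradient of `-log det` is `b⁻²`-Lipschitz on the matrices bounded below by `b`; this is the
resulting upper quadratic bound, with twice the optimal constant. -/
theorem neg_log_det_le_quadratic {b : ℝ} (hb : 0 < b) {θ₁ θ₂ : Matrix (Fin p) (Fin p) ℝ}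
    (h₁ : (θ₁ - b • (1 : Matrix (Fin p) (Fin p) ℝ)).PosSemidef)
    (h₂ : (θ₂ - b • (1 : Matrix (Fin p) (Fin p) ℝ)).PosSemidef) :
    -Real.log θ₂.det ≤ -Real.log θ₁.det - (θ₁⁻¹ * (θ₂ - θ₁)).trace +
      (b ^ 2)⁻¹ * frobNorm (θ₂ - θ₁) ^ 2 := by
  have hp₁ := posDef_of_sub_smul_one hb h₁
  have hp₂ := posDef_of_sub_smul_one hb h₂
  have hu₁ := (Matrix.isUnit_iff_isUnit_det _).mp hp₁.isUnit
  have hu₂ := (Matrix.isUnit_iff_isUnit_det _).mp hp₂.isUnit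
  -- Linearizing at `θ₂` instead of `θ₁` leaves the error `tr((θ₁⁻¹ - θ₂⁻¹)(θ₂ - θ₁))`, which `e`
  -- bounds.
  have h := hp₂.log_det_sub_log_det_le hp₁
  have e := trace_mul_mul_le hb h₁ h₂ (θ₂ - θ₁)
  have hsym : (θ₂ - θ₁)ᵀ = θ₂ - θ₁ := (hp₂.isHermitian.sub hp₁.isHermitian).eq
  have hE : θ₁⁻¹ * (θ₂ - θ₁) * θ₂⁻¹ = θ₁⁻¹ - θ₂⁻¹ := by
    rw [Matrix.mul_sub, Matrix.sub_mul, Matrix.nonsing_inv_mul _ hu₁, Matrix.one_mul,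
      Matrix.mul_assoc, Matrix.mul_nonsing_inv _ hu₂, Matrix.mul_one]
  rw [← frobNorm_sq_eq_trace, hE, hsym, Matrix.sub_mul, Matrix.trace_sub] at e
  have hneg : (θ₂⁻¹ * (θ₁ - θ₂)).trace = -(θ₂⁻¹ * (θ₂ - θ₁)).trace := by
    rw [← Matrix.trace_neg, ← Matrix.mul_neg, neg_sub]
  rw [hneg] at h
  rw [← le_inv_mul_iff₀ (by positivity)] at e
  linarith

theorem posSemidef_specNorm_sub {S : Matrix (Fin p) (Fin p) ℝ} (hS : S.IsHermitian) :
    (specNorm S • (1 : Matrix (Fin p) (Fin p) ℝ) - S).PosSemidef := by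
  refine Matrix.PosSemidef.of_dotProduct_mulVec_nonneg
    ((Matrix.isHermitian_one.smul (by exact IsSelfAdjoint.all _)).sub hS) fun x => ?_
  have h := real_inner_le_norm (WithLp.toLp 2 x)
    (Matrix.toEuclideanCLM (n := Fin p) (𝕜 := ℝ) S (WithLp.toLp 2 x))
  rw [Matrix.inner_toEuclideanCLM] at h
  have h2 := (Matrix.toEuclideanCLM (n := Fin p) (𝕜 := ℝ) S).le_opNorm (WithLp.toLp 2 x)
  have h3 : ‖WithLp.toLp 2 x‖ ^ 2 = x ⬝ᵥ x := by
    rw [EuclideanSpace.norm_sq_eq]; simp [dotProduct, sq]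
  simp only [star_trivial, Matrix.sub_mulVec, Matrix.smul_mulVec, Matrix.one_mulVec,
    dotProduct_sub, dotProduct_smul, smul_eq_mul, sub_nonneg, ← h3]
  refine h.trans ?_
  have := mul_le_mul_of_nonneg_left h2 (norm_nonneg (WithLp.toLp 2 x))
  rw [specNorm]
  nlinarith

/-- Source of the term `α p λ` in `mu`: the soft-thresholding residual is controlled only entrywise.
-/
theorem posSemidef_of_entries_le {N : Matrix (Fin p) (Fin p) ℝ} (hN : N.IsHermitian) {r : ℝ}
    (hr : ∀ i j, |N i j| ≤ r) :
    ((p * r) • (1 : Matrix (Fin p) (Fin p) ℝ) - N).PosSemidef := by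
  refine Matrix.PosSemidef.of_dotProduct_mulVec_nonneg
    ((Matrix.isHermitian_one.smul (by exact IsSelfAdjoint.all _)).sub hN) fun x => ?_
  simp only [star_trivial, Matrix.sub_mulVec, Matrix.smul_mulVec, Matrix.one_mulVec,
    dotProduct_sub, dotProduct_smul, smul_eq_mul, sub_nonneg]
  have h1 : x ⬝ᵥ N *ᵥ x ≤ ∑ i, ∑ j, r * ((x i ^ 2 + x j ^ 2) / 2) := by
    simp only [dotProduct, Matrix.mulVec, Finset.mul_sum]
    refine Finset.sum_le_sum fun i _ => Finset.sum_le_sum fun j _ => ?_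
    calc x i * (N i j * x j) ≤ |N i j| * (|x i| * |x j|) := by
          rw [← abs_mul, ← abs_mul]; refine le_trans (le_of_eq (by ring)) (le_abs_self _)
      _ ≤ r * ((x i ^ 2 + x j ^ 2) / 2) := by
          refine mul_le_mul (hr i j) ?_ (by positivity) ((abs_nonneg _).trans (hr i j))
          nlinarith [sq_nonneg (|x i| - |x j|), sq_abs (x i), sq_abs (x j)]
  refine h1.trans (le_of_eq ?_)
  simp only [← Finset.mul_sum, ← Finset.sum_div, Finset.sum_add_distrib, Finset.sum_const,
    Finset.card_univ, Fintype.card_fin, nsmul_eq_mul, dotProduct, ← sq]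
  ring

end Frobenius

namespace ChangePointProblem

variable {p : ℕ} (P : ChangePointProblem p)

/-! ### The elastic-net proximal map. -/

section Prox

open Matrix

variable {s : ℝ}

/-- With `sub_prox_mul_prox`, this says that the residual is `α s` times a subgradient of `|·|` at
the proximal point. -/
theorem abs_sub_prox_le (hα₀ : 0 ≤ P.α) (hα₁ : P.α < 1) (hs : 0 ≤ s)
    (θ : Matrix (Fin p) (Fin p) ℝ) (i j : Fin p) :
    |θ i j - (1 + (1 - P.α) * s) * P.prox s θ i j| ≤ P.α * s := by
  have hm : 0 ≤ (1 - P.α) * s := mul_nonneg (by linarith) hs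
  have ht : 0 ≤ P.α * s := mul_nonneg hα₀ hs
  simp only [prox, Matrix.of_apply]
  split_ifs with h1 h2
  · simpa using h1.le
  · rw [mul_div_cancel₀ _ (by positivity), sub_sub_cancel, abs_of_nonneg ht]
  · rw [mul_div_cancel₀ _ (by positivity), sub_add_cancel_left, abs_neg, abs_of_nonneg ht]

theorem sub_prox_mul_prox (hα₀ : 0 ≤ P.α) (hα₁ : P.α < 1) (hs : 0 ≤ s)
    (θ : Matrix (Fin p) (Fin p) ℝ) (i j : Fin p) :
    (θ i j - (1 + (1 - P.α) * s) * P.prox s θ i j) * P.prox s θ i j =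
      P.α * s * |P.prox s θ i j| := by
  have hm : 0 ≤ (1 - P.α) * s := mul_nonneg (by linarith) hs
  have ht : 0 ≤ P.α * s := mul_nonneg hα₀ hs
  simp only [prox, Matrix.of_apply]
  split_ifs with h1 h2
  · simp
  · rw [mul_div_cancel₀ _ (by positivity), sub_sub_cancel,
      abs_of_nonneg (div_nonneg (by linarith) (by positivity))]
  · have h3 : θ i j + P.α * s ≤ 0 := by
      rcases abs_cases (θ i j) with h | h <;> linarith
    rw [mul_div_cancel₀ _ (by positivity), sub_add_cancel_left,
      abs_of_nonpos (div_nonpos_of_nonpos_of_nonneg h3 (by positivity))]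
    ring

theorem prox_isHermitian {θ : Matrix (Fin p) (Fin p) ℝ} (hθ : θ.IsHermitian) :
    (P.prox s θ).IsHermitian := by
  ext i j
  have : θ j i = θ i j := by simpa using hθ.apply i j
  simp [prox, this]

/-- The proximal inequality for the strongly convex penalty. -/
theorem pen_prox_le (hα₀ : 0 ≤ P.α) (hα₁ : P.α < 1) (hs : 0 ≤ s)
    (θ u : Matrix (Fin p) (Fin p) ℝ) :
    s * P.pen (P.prox s θ) + ((θ - P.prox s θ) * (u - P.prox s θ)ᵀ).trace +
      s * (1 - P.α) / 2 * frobNorm (u - P.prox s θ) ^ 2 ≤ s * P.pen u := by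
  simp only [pen, trace_mul_transpose_eq_sum, frobNorm_sq, mul_add, Finset.mul_sum,
    ← Finset.sum_add_distrib]
  refine Finset.sum_le_sum fun i _ => Finset.sum_le_sum fun j _ => ?_
  have h1 := P.abs_sub_prox_le hα₀ hα₁ hs θ i j
  have h2 := P.sub_prox_mul_prox hα₀ hα₁ hs θ i j
  simp only [Matrix.sub_apply]
  generalize P.prox s θ i j = y at *
  generalize hN : θ i j - (1 + (1 - P.α) * s) * y = N at *
  have h3 : N * u i j ≤ P.α * s * |u i j| :=
    (le_abs_self _).trans (by rw [abs_mul]; gcongr)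
  have h4 : θ i j - y = N + (1 - P.α) * s * y := by rw [← hN]; ring
  rw [h4]
  nlinarith

/-- Entrywise, the input difference is `1 + (1 - α) s` times the output difference plus a difference
of subgradients, and the two have a nonnegative product by monotonicity. -/
theorem frobNorm_prox_sub_le (hα₀ : 0 ≤ P.α) (hα₁ : P.α < 1) (hs : 0 ≤ s)
    (θ₁ θ₂ : Matrix (Fin p) (Fin p) ℝ) :
    (1 + (1 - P.α) * s) * frobNorm (P.prox s θ₁ - P.prox s θ₂) ≤ frobNorm (θ₁ - θ₂) := by
  have hm : 0 ≤ (1 - P.α) * s := mul_nonneg (by linarith) hs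
  refine le_of_sq_le_sq ?_ (frobNorm_nonneg _)
  rw [mul_pow]
  simp only [frobNorm_sq, Finset.mul_sum]
  refine Finset.sum_le_sum fun i _ => Finset.sum_le_sum fun j _ => ?_
  have a1 := P.abs_sub_prox_le hα₀ hα₁ hs θ₁ i j
  have a2 := P.sub_prox_mul_prox hα₀ hα₁ hs θ₁ i j
  have b1 := P.abs_sub_prox_le hα₀ hα₁ hs θ₂ i j
  have b2 := P.sub_prox_mul_prox hα₀ hα₁ hs θ₂ i j
  simp only [Matrix.sub_apply]
  generalize P.prox s θ₁ i j = y₁ at *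
  generalize P.prox s θ₂ i j = y₂ at *
  generalize hN₁ : θ₁ i j - (1 + (1 - P.α) * s) * y₁ = N₁ at *
  generalize hN₂ : θ₂ i j - (1 + (1 - P.α) * s) * y₂ = N₂ at *
  have c1 : N₁ * y₂ ≤ P.α * s * |y₂| := (le_abs_self _).trans (by rw [abs_mul]; gcongr)
  have c2 : N₂ * y₁ ≤ P.α * s * |y₁| := (le_abs_self _).trans (by rw [abs_mul]; gcongr)
  have hmono : 0 ≤ (N₁ - N₂) * (y₁ - y₂) := by nlinarith
  have e : θ₁ i j - θ₂ i j = (1 + (1 - P.α) * s) * (y₁ - y₂) + (N₁ - N₂) := by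
    rw [← hN₁, ← hN₂]; ring
  rw [e]
  nlinarith [sq_nonneg (N₁ - N₂), mul_nonneg hm hmono]

end Prox

/-! ### Bounds over the grid and the equation for `b`. -/

section Grid

variable {P}

theorem finite_grid : P.grid.Finite := Set.finite_Icc _ _

theorem T_pos_of_mem_grid (hn₀ : 1 ≤ P.n₀) {t : ℕ} (ht : t ∈ P.grid) : 0 < P.T := by
  have := ht.1; have := ht.2; omega

theorem weight_nonneg {t : ℕ} (ht : t ≤ P.T) (j : Fin 2) : 0 ≤ P.weight j t := by
  unfold weight
  have : (t : ℝ) / P.T ≤ 1 := div_le_one_of_le₀ (by exact_mod_cast ht) (by positivity)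
  split_ifs
  · positivity
  · linarith

theorem weight_le_half {t : ℕ} (ht : t ≤ P.T) (j : Fin 2) : P.weight j t ≤ 1 / 2 := by
  unfold weight
  have : (t : ℝ) / P.T ≤ 1 := div_le_one_of_le₀ (by exact_mod_cast ht) (by positivity)
  have : 0 ≤ (t : ℝ) / P.T := by positivity
  split_ifs <;> linarith

theorem le_weight (hn₀ : 1 ≤ P.n₀) {t : ℕ} (ht : t ∈ P.grid) (j : Fin 2) :
    (1 / 2) * ((P.n₀ : ℝ) / P.T) ≤ P.weight j t := by
  have hT : (0 : ℝ) < P.T := by exact_mod_cast T_pos_of_mem_grid hn₀ ht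
  unfold weight
  have h1 : (P.n₀ : ℝ) ≤ t := by exact_mod_cast ht.1
  have h2 : (P.n₀ : ℝ) + t ≤ P.T := by
    have := ht.1; have := ht.2; norm_cast; omega
  split_ifs
  · gcongr
  · rw [one_sub_div hT.ne']
    gcongr
    linarith

theorem S_isHermitian (j : Fin 2) (t : ℕ) : (P.S j t).IsHermitian := by
  have h (x : Fin p → ℝ) : (Matrix.vecMulVec x x).IsHermitian := by
    simpa using (Matrix.posSemidef_vecMulVec_self_star x).isHermitian
  have hs (s : Finset ℕ) : (∑ t ∈ s, Matrix.vecMulVec (P.X t) (P.X t)).IsHermitian := by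
    rw [Matrix.IsHermitian, Matrix.conjTranspose_sum]
    exact Finset.sum_congr rfl fun t _ => h _
  unfold S
  split_ifs <;> exact (hs _).smul (IsSelfAdjoint.all _)

theorem specNorm_add_le_mu {t : ℕ} (ht : t ∈ P.grid) (j : Fin 2) :
    (1 / 2) * specNorm (P.S j t) + P.α * p * P.lam j t ≤ P.mu j := by
  have := (finite_grid (P := P)).to_subtype
  exact le_ciSup (f := fun τ : P.grid => (1 / 2) * specNorm (P.S j τ) + P.α * p * P.lam j τ)
    (Set.finite_range _).bddAbove ⟨t, ht⟩

theorem lam_le_lamMax {t : ℕ} (ht : t ∈ P.grid) (j : Fin 2) : P.lam j t ≤ P.lamMax j := by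
  have := (finite_grid (P := P)).to_subtype
  exact le_ciSup (f := fun τ : P.grid => P.lam j τ) (Set.finite_range _).bddAbove ⟨t, ht⟩

theorem b_pos (hn₀ : 1 ≤ P.n₀) (hα₁ : P.α < 1) {t : ℕ} (ht : t ∈ P.grid) {j : Fin 2}
    (hlam : 0 < P.lam j t) : 0 < P.b j := by
  have hT : (0 : ℝ) < P.T := by exact_mod_cast T_pos_of_mem_grid hn₀ ht
  have hn : (0 : ℝ) < P.n₀ := by exact_mod_cast hn₀
  have hL : 0 < P.lamMax j := hlam.trans_le (P.lam_le_lamMax ht j)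
  have h1 : 0 < 1 - P.α := by linarith
  unfold b
  refine div_pos ?_ (by positivity)
  have : P.mu j < Real.sqrt (P.mu j ^ 2 + 2 * P.lamMax j * (1 - P.α) * ((P.n₀ : ℝ) / P.T)) :=
    Real.lt_sqrt_of_sq_lt (lt_add_of_pos_right _ (by positivity))
  linarith

/-- The balance that makes `θ ≥ b` invariant under the step. -/
theorem b_quadratic (hn₀ : 1 ≤ P.n₀) (hα₁ : P.α < 1) {t : ℕ} (ht : t ∈ P.grid) {j : Fin 2}
    (hlam : 0 < P.lam j t) :
    (1 - P.α) * P.lamMax j * P.b j ^ 2 + P.mu j * P.b j = (1 / 2) * ((P.n₀ : ℝ) / P.T) := by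
  have hT : (0 : ℝ) < P.T := by exact_mod_cast T_pos_of_mem_grid hn₀ ht
  have hn : (0 : ℝ) < P.n₀ := by exact_mod_cast hn₀
  have hL : 0 < P.lamMax j := hlam.trans_le (P.lam_le_lamMax ht j)
  have h1 : 0 < 1 - P.α := by linarith
  have hsq := Real.sq_sqrt (x := P.mu j ^ 2 + 2 * P.lamMax j * (1 - P.α) * ((P.n₀ : ℝ) / P.T))
    (by positivity)
  have hb : 2 * (1 - P.α) * P.lamMax j * P.b j = -P.mu j +
      Real.sqrt (P.mu j ^ 2 + 2 * P.lamMax j * (1 - P.α) * ((P.n₀ : ℝ) / P.T)) := by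
    unfold b; field_simp
  rw [← sub_eq_iff_eq_add'.mpr hb] at hsq
  have hk : 0 < 4 * ((1 - P.α) * P.lamMax j) := by positivity
  refine mul_left_cancel₀ hk.ne' ?_
  linear_combination hsq

end Grid

end ChangePointProblem

/-! ### The proximal-gradient step: invariance, contraction, fixed point, descent. -/

namespace ChangePointProblem

variable {p : ℕ} (P : ChangePointProblem p)

/-- One proximal-gradient step on segment `j` for the change-point `t`. -/
noncomputable def proxGradStep (γ : ℝ) (j : Fin 2) (t : ℕ) (θ : Matrix (Fin p) (Fin p) ℝ) :
    Matrix (Fin p) (Fin p) ℝ :=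
  P.prox (γ * P.lam j t) (θ - γ • P.gradG j t θ)

/-- The penalized objective of a segment at a positive definite matrix, as a real number. -/
noncomputable def objReal (j : Fin 2) (t : ℕ) (θ : Matrix (Fin p) (Fin p) ℝ) : ℝ :=
  P.weight j t * (-Real.log θ.det + (θ * P.S j t).trace) + P.lam j t * P.pen θ

/-- `θ` is symmetric with all eigenvalues at least `P.b j`. -/
def SpecGE (j : Fin 2) (θ : Matrix (Fin p) (Fin p) ℝ) : Prop :=
  (θ - P.b j • (1 : Matrix (Fin p) (Fin p) ℝ)).PosSemidef

/-- The conditions under which the proximal-gradient step is a well-behaved contraction. -/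
structure StepAdmissible (γ : ℝ) (j : Fin 2) (t : ℕ) : Prop where
  one_le_n₀ : 1 ≤ P.n₀
  α_nonneg : 0 ≤ P.α
  α_lt_one : P.α < 1
  mem_grid : t ∈ P.grid
  lam_pos : 0 < P.lam j t
  γ_pos : 0 < γ
  γ_le : γ ≤ P.b j ^ 2

variable {P}

theorem obj_eq_objReal {j : Fin 2} {t : ℕ} {θ : Matrix (Fin p) (Fin p) ℝ} (hθ : θ.PosDef) :
    P.obj j t θ = (P.objReal j t θ : EReal) := by
  simp [obj, g, hθ, objReal]

theorem specGE_of_pdBetween {j : Fin 2} {θ : Matrix (Fin p) (Fin p) ℝ}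
    (h : PDBetween (P.b j) (P.B j) θ) : P.SpecGE j θ := by
  obtain ⟨hθ, hev⟩ := h
  have hD : (Matrix.diagonal fun i => hθ.isHermitian.eigenvalues i - P.b j).PosSemidef :=
    Matrix.PosSemidef.diagonal fun i => sub_nonneg.mpr (hev i).1
  have h1 := hD.mul_mul_conjTranspose_same
    (hθ.isHermitian.eigenvectorUnitary : Matrix (Fin p) (Fin p) ℝ)
  refine (congrArg Matrix.PosSemidef ?_).mp h1
  have hU : (hθ.isHermitian.eigenvectorUnitary : Matrix (Fin p) (Fin p) ℝ) *
      Matrix.conjTranspose (hθ.isHermitian.eigenvectorUnitary : Matrix (Fin p) (Fin p) ℝ) = 1 :=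
    Unitary.coe_mul_star_self _
  have hsp := hθ.isHermitian.spectral_theorem
  rw [Unitary.conjStarAlgAut_apply] at hsp
  have hd : (Matrix.diagonal fun i => hθ.isHermitian.eigenvalues i - P.b j) =
      Matrix.diagonal (RCLike.ofReal ∘ hθ.isHermitian.eigenvalues) -
        P.b j • (1 : Matrix (Fin p) (Fin p) ℝ) := by
    ext i k
    by_cases hik : i = k
    · subst hik; simp
    · simp [hik]
  rw [hd, Matrix.mul_sub, Matrix.sub_mul, Matrix.mul_smul, Matrix.smul_mul, Matrix.mul_one, hU]
  congr 1
  exact hsp.symm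

namespace StepAdmissible

open Matrix

variable {γ : ℝ} {j : Fin 2} {t : ℕ} (h : P.StepAdmissible γ j t)
  {θ θ₁ θ₂ u : Matrix (Fin p) (Fin p) ℝ}

include h

theorem le_T : t ≤ P.T := h.mem_grid.2.trans (Nat.sub_le _ _)

theorem scale_pos : 0 < γ * P.lam j t := mul_pos h.γ_pos h.lam_pos

theorem b_pos : 0 < P.b j :=
  ChangePointProblem.b_pos h.one_le_n₀ h.α_lt_one h.mem_grid h.lam_pos

theorem posDef (hθ : P.SpecGE j θ) : θ.PosDef := posDef_of_sub_smul_one h.b_pos hθ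

theorem step_weight_nonneg : 0 ≤ γ * P.weight j t :=
  mul_nonneg h.γ_pos.le (weight_nonneg h.le_T j)

theorem step_weight_le : γ * P.weight j t ≤ P.b j ^ 2 := by
  have := weight_le_half h.le_T j
  have := h.γ_le
  have := h.γ_pos
  nlinarith

omit h in
theorem sub_smul_gradG (γ : ℝ) (j : Fin 2) (t : ℕ) (θ : Matrix (Fin p) (Fin p) ℝ) :
    θ - γ • P.gradG j t θ =
      (θ + (γ * P.weight j t) • θ⁻¹) - (γ * P.weight j t) • P.S j t := by
  rw [gradG]; module

theorem isHermitian_sub_smul_gradG (hθ : P.SpecGE j θ) :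
    (θ - γ • P.gradG j t θ).IsHermitian :=
  (h.posDef hθ).isHermitian.sub (((S_isHermitian j t).sub
    (h.posDef hθ).inv.isHermitian).smul (IsSelfAdjoint.all _) |>.smul (IsSelfAdjoint.all _))

/-- With `c = γ w`, `(1 + m)` times the step is `(θ + c θ⁻¹) - c S - N`. The three terms are bounded
below by `b + c / b`, `-c‖S‖₂` and `-p α s`. -/
theorem specGE_step (hθ : P.SpecGE j θ) : P.SpecGE j (P.proxGradStep γ j t θ) := by
  set s := γ * P.lam j t with hs
  set m := (1 - P.α) * s with hm
  have hm0 : 0 ≤ m := mul_nonneg (by linarith [h.α_lt_one]) h.scale_pos.le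
  set V := θ - γ • P.gradG j t θ with hV
  set N := V - (1 + m) • P.proxGradStep γ j t θ with hN
  have hstep : P.proxGradStep γ j t θ = P.prox s V := rfl
  have hNh : N.IsHermitian :=
    (h.isHermitian_sub_smul_gradG hθ).sub
      ((P.prox_isHermitian (h.isHermitian_sub_smul_gradG hθ)).smul (IsSelfAdjoint.all _))
  have p1 := posSemidef_add_smul_inv h.b_pos h.step_weight_le hθ
  have p2 := posSemidef_of_entries_le hNh (r := P.α * s) fun i k => by
    simpa [hN, hstep] using P.abs_sub_prox_le h.α_nonneg h.α_lt_one h.scale_pos.le V i k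
  have p3 := (posSemidef_specNorm_sub (S_isHermitian (P := P) j t)).smul h.step_weight_nonneg
  -- What remains of these bounds after subtracting `(1 + m) b`; nonnegative by `b_quadratic`, since
  -- `n₀ / (2T) ≤ w ≤ 1 / 2`.
  have hr : 0 ≤ γ * P.weight j t / P.b j - γ * P.weight j t * specNorm (P.S j t) -
      p * (P.α * s) - m * P.b j := by
    have q := b_quadratic h.one_le_n₀ h.α_lt_one h.mem_grid h.lam_pos
    have w1 := le_weight h.one_le_n₀ h.mem_grid j
    have w2 := weight_le_half h.le_T j
    have l := lam_le_lamMax h.mem_grid j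
    have μ := specNorm_add_le_mu h.mem_grid j
    have hb := h.b_pos
    have hS : 0 ≤ specNorm (P.S j t) := norm_nonneg _
    have hα : 0 < 1 - P.α := by linarith [h.α_lt_one]
    have k1 : P.mu j + (1 - P.α) * P.lam j t * P.b j ≤ P.weight j t / P.b j := by
      rw [le_div_iff₀ hb]
      have : (1 - P.α) * P.lam j t * P.b j ^ 2 ≤ (1 - P.α) * P.lamMax j * P.b j ^ 2 := by gcongr
      nlinarith
    have k2 : P.weight j t * specNorm (P.S j t) ≤ 1 / 2 * specNorm (P.S j t) := by gcongr
    have k3 : 0 ≤ P.weight j t / P.b j - P.weight j t * specNorm (P.S j t) -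
      P.α * p * P.lam j t - (1 - P.α) * P.lam j t * P.b j := by linarith
    have := mul_nonneg h.γ_pos.le k3
    refine this.trans_eq ?_
    rw [hm, hs]
    ring
  have p4 := (p1.add (p2.add p3)).add (Matrix.PosSemidef.one.smul hr)
  have p5 := p4.smul (inv_nonneg.mpr (by linarith : 0 ≤ 1 + m))
  refine (congrArg Matrix.PosSemidef ?_).mp p5
  have hV' := sub_smul_gradG (P := P) γ j t θ
  have hsol : (1 + m) • P.proxGradStep γ j t θ = V - N := by rw [hN]; abel
  rw [← hV] at hV'
  have hm1 : (1 + m) ≠ 0 := by positivity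
  rw [inv_smul_eq_iff₀ hm1, smul_sub (1 + m) (P.proxGradStep γ j t θ), hsol, hV']
  module

theorem frobNorm_step_sub_le (h₁ : P.SpecGE j θ₁) (h₂ : P.SpecGE j θ₂) :
    (1 + (1 - P.α) * (γ * P.lam j t)) *
      frobNorm (P.proxGradStep γ j t θ₁ - P.proxGradStep γ j t θ₂) ≤ frobNorm (θ₁ - θ₂) := by
  refine (P.frobNorm_prox_sub_le h.α_nonneg h.α_lt_one h.scale_pos.le _ _).trans ?_
  rw [sub_smul_gradG, sub_smul_gradG, sub_sub_sub_cancel_right]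
  exact frobNorm_add_smul_inv_sub_le h.b_pos h.step_weight_nonneg h.step_weight_le h₁ h₂

open scoped Matrix.Norms.Frobenius in
theorem exists_isFixedPt : ∃ θ, P.SpecGE j θ ∧ P.proxGradStep γ j t θ = θ := by
  have hmaps : Set.MapsTo (P.proxGradStep γ j t) {θ | P.SpecGE j θ} {θ | P.SpecGE j θ} :=
    fun θ hθ => h.specGE_step hθ
  have hclosed : IsClosed {θ | P.SpecGE j θ} := by
    simp only [SpecGE, Matrix.posSemidef_iff_dotProduct_mulVec, Set.ofPred_and, Set.ofPred_forall,
      Matrix.IsHermitian, dotProduct, Matrix.mulVec]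
    refine (isClosed_eq ?_ ?_).inter (isClosed_iInter fun x => isClosed_le ?_ ?_)
    all_goals fun_prop
  have hm : 0 < (1 - P.α) * (γ * P.lam j t) :=
    mul_pos (by linarith [h.α_lt_one]) h.scale_pos
  have hcontr : ContractingWith (Real.toNNReal (1 + (1 - P.α) * (γ * P.lam j t))⁻¹)
      (hmaps.restrict _ _ _) := by
    refine ⟨?_, LipschitzWith.of_dist_le_mul fun x y => ?_⟩
    · rw [Real.toNNReal_lt_one]
      exact inv_lt_one_of_one_lt₀ (by linarith)
    · rw [Real.coe_toNNReal _ (by positivity), Subtype.dist_eq, Subtype.dist_eq, dist_eq_norm,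
        dist_eq_norm, ← frobNorm_eq_norm, ← frobNorm_eq_norm, le_inv_mul_iff₀ (by positivity)]
      exact h.frobNorm_step_sub_le x.2 y.2
  have hne : P.SpecGE j (P.b j • (1 : Matrix (Fin p) (Fin p) ℝ)) := by
    simpa [SpecGE] using Matrix.PosSemidef.zero
  obtain ⟨y, hy, hfix, -⟩ := hcontr.exists_fixedPoint' hclosed.isComplete hmaps hne
    (edist_ne_top _ _)
  exact ⟨y, hy, hfix⟩

/-- The proximal inequality divided by `γ`. At a fixed point it yields quadratic growth; at `u = θ`
it yields descent. -/
theorem lam_mul_pen_step_le (θ u : Matrix (Fin p) (Fin p) ℝ) :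
    P.lam j t * P.pen (P.proxGradStep γ j t θ) +
      γ⁻¹ * ((θ - P.proxGradStep γ j t θ) * (u - P.proxGradStep γ j t θ)ᵀ).trace -
      P.weight j t * ((P.S j t - θ⁻¹) * (u - P.proxGradStep γ j t θ)ᵀ).trace +
      P.lam j t * (1 - P.α) / 2 * frobNorm (u - P.proxGradStep γ j t θ) ^ 2 ≤
      P.lam j t * P.pen u := by
  have hp := P.pen_prox_le h.α_nonneg h.α_lt_one h.scale_pos.le (θ - γ • P.gradG j t θ) u
  change γ * P.lam j t * P.pen (P.proxGradStep γ j t θ) +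
    ((θ - γ • P.gradG j t θ - P.proxGradStep γ j t θ) * (u - P.proxGradStep γ j t θ)ᵀ).trace +
    γ * P.lam j t * (1 - P.α) / 2 * frobNorm (u - P.proxGradStep γ j t θ) ^ 2 ≤ _ at hp
  rw [sub_right_comm, gradG, Matrix.sub_mul (θ - _), Matrix.trace_sub, Matrix.smul_mul,
    Matrix.smul_mul, Matrix.trace_smul, Matrix.trace_smul, smul_eq_mul, smul_eq_mul] at hp
  refine le_of_mul_le_mul_left (le_trans (le_of_eq ?_) (hp.trans (le_of_eq (mul_assoc _ _ _))))
    h.γ_pos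
  have := h.γ_pos.ne'
  field_simp
  ring

/-- A fixed point of the step satisfies the quadratic growth inequality around a minimizer. -/
theorem objReal_add_le_of_isFixedPt (hθ : P.SpecGE j θ) (hfix : P.proxGradStep γ j t θ = θ)
    (hu : u.PosDef) :
    P.objReal j t θ + P.lam j t * (1 - P.α) / 2 * frobNorm (u - θ) ^ 2 ≤ P.objReal j t u := by
  have hp := h.lam_mul_pen_step_le θ u
  rw [hfix] at hp
  have hl := (h.posDef hθ).log_det_sub_log_det_le hu
  have hsym : (u - θ)ᵀ = u - θ := (hu.isHermitian.sub (h.posDef hθ).isHermitian).eq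
  rw [hsym, sub_self, Matrix.zero_mul, Matrix.trace_zero, Matrix.sub_mul, Matrix.trace_sub,
    Matrix.trace_mul_comm (P.S j t), Matrix.sub_mul, Matrix.trace_sub] at hp
  have := mul_le_mul_of_nonneg_left hl (weight_nonneg h.le_T j)
  simp only [objReal]
  linarith

/-- The proximal inequality gains `γ⁻¹‖θ' - θ‖²`; the curvature of `-log det` costs at most half of
it, because `w ≤ 1 / 2` and `γ ≤ b²`. -/
theorem objReal_step_le (hθ : P.SpecGE j θ) :
    P.objReal j t (P.proxGradStep γ j t θ) +
      (2 * γ)⁻¹ * frobNorm (P.proxGradStep γ j t θ - θ) ^ 2 ≤ P.objReal j t θ := by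
  have hp := h.lam_mul_pen_step_le θ θ
  have hθ' := h.specGE_step hθ
  set θ' := P.proxGradStep γ j t θ with hdef
  have hq := neg_log_det_le_quadratic h.b_pos hθ hθ'
  have hsym : (θ - θ')ᵀ = θ - θ' := ((h.posDef hθ).isHermitian.sub (h.posDef hθ').isHermitian).eq
  rw [← frobNorm_sq_eq_trace, frobNorm_sub_rev θ θ', hsym, Matrix.sub_mul, Matrix.trace_sub,
    Matrix.trace_mul_comm (P.S j t), Matrix.sub_mul, Matrix.trace_sub,
    Matrix.mul_sub, Matrix.trace_sub] at hp
  rw [Matrix.mul_sub, Matrix.trace_sub] at hq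
  have hw := mul_le_mul_of_nonneg_left hq (weight_nonneg h.le_T j)
  have hF := sq_nonneg (frobNorm (θ' - θ))
  have hc : P.weight j t * (P.b j ^ 2)⁻¹ ≤ (2 * γ)⁻¹ := by
    rw [mul_inv]
    have : (P.b j ^ 2)⁻¹ ≤ γ⁻¹ := inv_anti₀ h.γ_pos h.γ_le
    have := weight_le_half h.le_T j
    have := inv_pos.mpr h.γ_pos
    exact mul_le_mul (by linarith) ‹_› (by positivity) (by norm_num)
  have hcF := mul_le_mul_of_nonneg_right hc hF
  have hg : γ⁻¹ = (2 * γ)⁻¹ + (2 * γ)⁻¹ := by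
    have := h.γ_pos.ne'
    field_simp
    norm_num
  have hn : 0 ≤ P.lam j t * (1 - P.α) / 2 * frobNorm (θ' - θ) ^ 2 :=
    mul_nonneg (div_nonneg (mul_nonneg h.lam_pos.le (by linarith [h.α_lt_one])) (by norm_num)) hF
  rw [hg] at hp
  simp only [objReal]
  nlinarith

theorem isGlasso_of_isFixedPt (hθ : P.SpecGE j θ) (hfix : P.proxGradStep γ j t θ = θ) :
    P.IsGlasso j t θ := by
  refine ⟨h.posDef hθ, fun u hu => ?_⟩
  rw [obj_eq_objReal (h.posDef hθ), obj_eq_objReal hu, EReal.coe_le_coe_iff]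
  refine le_trans (le_add_of_nonneg_right ?_) (h.objReal_add_le_of_isFixedPt hθ hfix hu)
  exact mul_nonneg (div_nonneg (mul_nonneg h.lam_pos.le (by linarith [h.α_lt_one]))
    (by norm_num)) (sq_nonneg _)

theorem eq_of_isGlasso (hθ : P.SpecGE j θ) (hfix : P.proxGradStep γ j t θ = θ)
    (hu : P.IsGlasso j t u) : u = θ := by
  have h1 := hu.2 θ (h.posDef hθ)
  rw [obj_eq_objReal (h.posDef hθ), obj_eq_objReal hu.1, EReal.coe_le_coe_iff] at h1
  have h2 := h.objReal_add_le_of_isFixedPt hθ hfix hu.1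
  have hk : 0 < P.lam j t * (1 - P.α) / 2 :=
    div_pos (mul_pos h.lam_pos (by linarith [h.α_lt_one])) (by norm_num)
  have h3 : frobNorm (u - θ) ^ 2 ≤ 0 := by
    by_contra! hlt
    have := mul_pos hk hlt
    linarith
  exact sub_eq_zero.mp (frobNorm_eq_zero.mp (pow_eq_zero_iff two_ne_zero |>.mp
    (le_antisymm h3 (sq_nonneg _))))

theorem isGlasso_glasso : P.IsGlasso j t (P.glasso j t) := by
  obtain ⟨θ, hθ, hfix⟩ := h.exists_isFixedPt
  exact Classical.epsilon_spec ⟨θ, h.isGlasso_of_isFixedPt hθ hfix⟩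

/-- Uniqueness identifies the chosen minimizer with the Banach fixed point. -/
theorem glasso_spec :
    P.SpecGE j (P.glasso j t) ∧ P.proxGradStep γ j t (P.glasso j t) = P.glasso j t := by
  obtain ⟨θ, hθ, hfix⟩ := h.exists_isFixedPt
  rw [h.eq_of_isGlasso hθ hfix h.isGlasso_glasso]
  exact ⟨hθ, hfix⟩

/-- Contraction towards the fixed point, combined with the triangle inequality through the new
iterate. -/
theorem frobNorm_step_sub_glasso_le (hθ : P.SpecGE j θ) :
    (1 - P.α) * (γ * P.lam j t) * frobNorm (P.proxGradStep γ j t θ - P.glasso j t) ≤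
      frobNorm (P.proxGradStep γ j t θ - θ) := by
  have h1 := h.frobNorm_step_sub_le hθ h.glasso_spec.1
  rw [h.glasso_spec.2] at h1
  have h2 := frobNorm_add_le (θ - P.proxGradStep γ j t θ)
    (P.proxGradStep γ j t θ - P.glasso j t)
  rw [sub_add_sub_cancel, frobNorm_sub_rev θ (P.proxGradStep γ j t θ)] at h2
  linarith

end StepAdmissible

end ChangePointProblem

/-! ### Two lemmas on real sequences. -/

/-- A sequence with `a (k + 1) ≤ κ a k + c` eventually has `limsup` at most `c / (1 - κ)`. -/
theorem limsup_le_of_eventually_affine_contraction {a : ℕ → ℝ} {κ c : ℝ} (ha : ∀ k, 0 ≤ a k)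
    (hκ₀ : 0 ≤ κ) (hκ₁ : κ < 1) (h : ∀ᶠ k in atTop, a (k + 1) ≤ κ * a k + c) :
    limsup a atTop ≤ c / (1 - κ) := by
  obtain ⟨K, hK⟩ := eventually_atTop.mp h
  have hfix : κ * (c / (1 - κ)) + c = c / (1 - κ) := by
    have : 1 - κ ≠ 0 := by linarith
    field_simp
    ring
  have hn (n : ℕ) : a (K + n) ≤ c / (1 - κ) + κ ^ n * (a K - c / (1 - κ)) := by
    induction n with
    | zero => simp
    | succ n ih =>
      have h1 := hK (K + n) (by omega)
      have h2 := mul_le_mul_of_nonneg_left ih hκ₀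
      rw [pow_succ, ← add_assoc]
      linarith
  have hlim : Tendsto (fun n => c / (1 - κ) + κ ^ n * (a K - c / (1 - κ))) atTop
      (𝓝 (c / (1 - κ))) := by
    simpa using ((tendsto_pow_atTop_nhds_zero_of_lt_one hκ₀ hκ₁).mul_const
      (a K - c / (1 - κ))).const_add (c / (1 - κ))
  refine le_of_forall_gt_imp_ge_of_dense fun d hd => ?_
  -- The lower bound `0 ≤ a k` makes the infimum defining the real `limsup` meaningful.
  refine limsup_le_of_le (isCoboundedUnder_le_of_le atTop ha) ?_
  obtain ⟨N, hN⟩ := eventually_atTop.mp (hlim.eventually (gt_mem_nhds hd))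
  refine eventually_atTop.mpr ⟨K + N, fun k hk => ?_⟩
  obtain ⟨n, rfl⟩ := Nat.exists_eq_add_of_le (show K ≤ k by omega)
  exact (hn n).trans (hN n (by omega)).le

/-- If a sequence bounded below decreases by at least `d k`, then `d k` tends to zero. -/
theorem tendsto_zero_of_sufficient_decrease {f d : ℕ → ℝ} (hd : ∀ k, 0 ≤ d k)
    (hf : ∀ k, f (k + 1) + d k ≤ f k) (hb : BddBelow (Set.range f)) :
    Tendsto d atTop (𝓝 0) := by
  have hanti : Antitone f := antitone_nat_of_succ_le fun k => by linarith [hd k, hf k]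
  have hlim := tendsto_atTop_ciInf hanti hb
  have hdiff := hlim.sub (hlim.comp (tendsto_add_atTop_nat 1))
  rw [sub_self] at hdiff
  exact squeeze_zero hd (fun k => by simp only [Function.comp]; linarith [hf k]) hdiff

/-! ### Convergence of runs. -/

namespace ChangePointProblem

variable {p : ℕ} {P : ChangePointProblem p} {γ : ℝ} {τ : ℕ → ℕ}
  {θ : Fin 2 → ℕ → Matrix (Fin p) (Fin p) ℝ}

namespace IsRun

theorem mem_grid (hrun : P.IsRun γ τ θ) (k : ℕ) : τ k ∈ P.grid := by
  cases k with
  | zero => exact hrun.τ_zero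
  | succ k => exact (hrun.τ_succ k).1

theorem θ_succ_eq (hrun : P.IsRun γ τ θ) (j : Fin 2) (k : ℕ) :
    θ j (k + 1) = P.proxGradStep γ j (τ k) (θ j k) := hrun.θ_succ j k

theorem specGE (hrun : P.IsRun γ τ θ) (hadm : ∀ j, ∀ t ∈ P.grid, P.StepAdmissible γ j t)
    (hinit : ∀ j, P.SpecGE j (θ j 0)) (j : Fin 2) (k : ℕ) : P.SpecGE j (θ j k) := by
  induction k with
  | zero => exact hinit j
  | succ k ih =>
    rw [hrun.θ_succ_eq]
    exact (hadm j _ (hrun.mem_grid k)).specGE_step ih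

variable (hrun : P.IsRun γ τ θ) (hadm : ∀ j, ∀ t ∈ P.grid, P.StepAdmissible γ j t)
  (hK : ∀ j k, P.SpecGE j (θ j k))

include hrun hadm hK

/-- Descent at the old change-point `τ k`, which then competes with `τ (k + 1)` in the grid
minimization. -/
theorem objReal_succ_le (k : ℕ) :
    P.objReal 0 (τ (k + 1)) (θ 0 (k + 1)) + P.objReal 1 (τ (k + 1)) (θ 1 (k + 1)) +
      (2 * γ)⁻¹ * (frobNorm (θ 0 (k + 1) - θ 0 k) ^ 2 + frobNorm (θ 1 (k + 1) - θ 1 k) ^ 2) ≤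
    P.objReal 0 (τ k) (θ 0 k) + P.objReal 1 (τ k) (θ 1 k) := by
  have hpd (j k) : (θ j k).PosDef := (hadm j _ (hrun.mem_grid k)).posDef (hK j k)
  have h1 := (hrun.τ_succ k).2 _ (hrun.mem_grid k)
  simp only [H, obj_eq_objReal (hpd _ _), ← EReal.coe_add, EReal.coe_le_coe_iff] at h1
  have h2 (j) := (hadm j _ (hrun.mem_grid k)).objReal_step_le (hK j k)
  simp only [← hrun.θ_succ_eq] at h2
  linarith [h2 0, h2 1]

theorem bddBelow_objReal :
    BddBelow (Set.range fun k => P.objReal 0 (τ k) (θ 0 k) + P.objReal 1 (τ k) (θ 1 k)) := by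
  obtain ⟨m, hm⟩ := ((finite_grid (P := P)).image
    fun t => P.objReal 0 t (P.glasso 0 t) + P.objReal 1 t (P.glasso 1 t)).bddBelow
  refine ⟨m, ?_⟩
  rintro _ ⟨k, rfl⟩
  refine (hm ⟨τ k, hrun.mem_grid k, rfl⟩).trans ?_
  have hle (j) : P.objReal j (τ k) (P.glasso j (τ k)) ≤ P.objReal j (τ k) (θ j k) := by
    have ha := hadm j _ (hrun.mem_grid k)
    have h1 := ha.isGlasso_glasso.2 _ (ha.posDef (hK j k))
    rwa [obj_eq_objReal ha.isGlasso_glasso.1, obj_eq_objReal (ha.posDef (hK j k)),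
      EReal.coe_le_coe_iff] at h1
  exact add_le_add (hle 0) (hle 1)

theorem tendsto_frobNorm_succ_sub (j : Fin 2) :
    Tendsto (fun k => frobNorm (θ j (k + 1) - θ j k)) atTop (𝓝 0) := by
  have hγ : 0 < γ := (hadm 0 _ hrun.τ_zero).γ_pos
  have h := tendsto_zero_of_sufficient_decrease
    (fun k => mul_nonneg (inv_nonneg.mpr (by positivity)) (by positivity))
    (hrun.objReal_succ_le hadm hK) (hrun.bddBelow_objReal hadm hK)
  have h2 := h.const_mul (2 * γ)
  simp only [mul_zero, mul_inv_cancel_left₀ (show 2 * γ ≠ 0 by positivity)] at h2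
  have h3 : Tendsto (fun k => frobNorm (θ j (k + 1) - θ j k) ^ 2) atTop (𝓝 0) := by
    refine squeeze_zero (fun k => sq_nonneg _) (fun k => ?_) h2
    have h0 := sq_nonneg (frobNorm (θ 0 (k + 1) - θ 0 k))
    have h1 := sq_nonneg (frobNorm (θ 1 (k + 1) - θ 1 k))
    fin_cases j
    · exact le_add_of_nonneg_right h1
    · exact le_add_of_nonneg_left h0
  have h4 := h3.sqrt
  simpa only [Real.sqrt_sq (frobNorm_nonneg _), Real.sqrt_zero] using h4

theorem tendsto_frobNorm_succ_sub_glasso (j : Fin 2) :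
    Tendsto (fun k => frobNorm (θ j (k + 1) - P.glasso j (τ k))) atTop (𝓝 0) := by
  have hm {t : ℕ} (ht : t ∈ P.grid) : 0 < (1 - P.α) * (γ * P.lam j t) :=
    mul_pos (by linarith [(hadm j t ht).α_lt_one]) (hadm j t ht).scale_pos
  obtain ⟨t₀, ht₀, hmin⟩ := (finite_grid (P := P)).exists_minimalFor
    (fun t => (1 - P.α) * (γ * P.lam j t)) _ ⟨τ 0, hrun.τ_zero⟩
  have hd := (hrun.tendsto_frobNorm_succ_sub hadm hK j).const_mul
    ((1 - P.α) * (γ * P.lam j t₀))⁻¹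
  rw [mul_zero] at hd
  refine squeeze_zero (fun k => frobNorm_nonneg _) (fun k => ?_) hd
  have h1 := (hadm j _ (hrun.mem_grid k)).frobNorm_step_sub_glasso_le (hK j k)
  rw [← hrun.θ_succ_eq] at h1
  rw [le_inv_mul_iff₀ (hm ht₀)]
  refine le_trans (mul_le_mul_of_nonneg_right ?_ (frobNorm_nonneg _)) h1
  -- `MinimalFor` only gives an implication; totality of the order turns it into a lower bound.
  exact (le_total _ _).elim id (hmin (hrun.mem_grid k))

theorem tendsto_frobNorm_sub_glasso (j : Fin 2) :
    Tendsto (fun k => frobNorm (θ j k - P.glasso j (τ k))) atTop (𝓝 0) := by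
  have h := (hrun.tendsto_frobNorm_succ_sub hadm hK j).add
    (hrun.tendsto_frobNorm_succ_sub_glasso hadm hK j)
  rw [add_zero] at h
  refine squeeze_zero (fun k => frobNorm_nonneg _) (fun k => ?_) h
  have := frobNorm_add_le (θ j k - θ j (k + 1)) (θ j (k + 1) - P.glasso j (τ k))
  rwa [sub_add_sub_cancel, frobNorm_sub_rev (θ j k) (θ j (k + 1))] at this

theorem limsup_abs_sub_le {ε c κ : ℝ} {τs : ℕ} (hC : P.Containment ε c κ τs) :
    limsup (fun k => |(τ k : ℝ) - τs|) atTop ≤ c / (1 - κ) := by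
  refine limsup_le_of_eventually_affine_contraction (fun k => abs_nonneg _) hC.κ_nonneg
    hC.κ_lt_one ?_
  -- The index shift matters: `τ (k + 1)` minimizes at the iterates `k + 1`, which must be close to
  -- the minimizers for `τ k`.
  have h := (hrun.tendsto_frobNorm_succ_sub_glasso hadm hK 0).add
    (hrun.tendsto_frobNorm_succ_sub_glasso hadm hK 1)
  rw [add_zero] at h
  filter_upwards [h.eventually (gt_mem_nhds hC.ε_pos)] with k hk
  exact hC.contain _ (hrun.mem_grid k) _ _
    ((hadm 0 _ (hrun.mem_grid k)).posDef (hK 0 (k + 1)))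
    ((hadm 1 _ (hrun.mem_grid k)).posDef (hK 1 (k + 1))) hk.le _ (hrun.τ_succ k)

end IsRun

end ChangePointProblem

theorem theorem1 {p : ℕ} (P : ChangePointProblem p)
    (hn₀ : 1 ≤ P.n₀) (hn₀T : P.n₀ < P.T)
    (hα₀ : 0 ≤ P.α) (hα₁ : P.α < 1)
    (hlam : ∀ j, ∀ τ ∈ P.grid, 0 < P.lam j τ)
    (γ : ℝ) (hγ₀ : 0 < γ) (hγ : γ ≤ min (P.b 0 ^ 2) (P.b 1 ^ 2))
    (τ : ℕ → ℕ) (θ : Fin 2 → ℕ → Matrix (Fin p) (Fin p) ℝ)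
    (hrun : P.IsRun γ τ θ)
    (hinit : ∀ j, PDBetween (P.b j) (P.B j) (θ j 0)) :
    (∀ j, ∀ t ∈ P.grid, P.IsGlasso j t (P.glasso j t) ∧
      ∀ ϑ, P.IsGlasso j t ϑ → ϑ = P.glasso j t) ∧
    (∀ j k, (θ j k).PosDef) ∧
    (∀ j, Tendsto (fun k => frobNorm (θ j k - P.glasso j (τ k))) atTop (𝓝 0)) ∧
    (∀ (ε c κ : ℝ) (τs : ℕ), P.Containment ε c κ τs →
      limsup (fun k => |(τ k : ℝ) - τs|) atTop ≤ c / (1 - κ)) := by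
  have hadm (j : Fin 2) (t : ℕ) (ht : t ∈ P.grid) : P.StepAdmissible γ j t := by
    refine ⟨hn₀, hα₀, hα₁, ht, hlam j t ht, hγ₀, ?_⟩
    rw [le_min_iff] at hγ
    fin_cases j
    exacts [hγ.1, hγ.2]
  have hK := hrun.specGE hadm fun j => ChangePointProblem.specGE_of_pdBetween (hinit j)
  refine ⟨fun j t ht => ⟨(hadm j t ht).isGlasso_glasso, fun ϑ hϑ => ?_⟩,
    fun j k => (hadm j _ (hrun.mem_grid k)).posDef (hK j k),
    hrun.tendsto_frobNorm_sub_glasso hadm hK,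
    fun ε c κ τs => hrun.limsup_abs_sub_le hadm hK⟩
  exact (hadm j t ht).eq_of_isGlasso (hadm j t ht).glasso_spec.1 (hadm j t ht).glasso_spec.2 hϑ
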